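/- Let $I$ be a set. A polyadic algebra (without equality) with index set $I$ is a Boolean algebra $A$ with operations $\mathsf c_{(\Gamma)}$ for all $\Gamma\subseteq I$ and $\mathsf s_\tau$ for all maps $\tau:I\to I$ such that, for all $x,y\in A$, $\Gamma,\Delta\subseteq I$ and $\sigma,\tau:I\to I$: $\mathsf c_{(\Gamma)}0=0$; $x\le \mathsf c_{(\Gamma)}x$; $\mathsf c_{(\Gamma)}(x\cdot \mathsf c_{(\Gamma)}y)=\mathsf c_{(\Gamma)}x\cdot \mathsf c_{(\Gamma)}y$; $\mathsf c_{(\emptyset)}x=x$; $\mathsf c_{(\Gamma)}\mathsf c_{(\Delta)}x=\mathsf c_{(\Gamma\cup\Delta)}x$; $\mathsf s_\tau$ is a Boolean endomorphism; $\mathsf s_{\mathrm{Id}}x=x$; $\mathsf s_{\sigma\circ\tau}x=\mathsf s_\sigma \mathsf s_\tau x$; if $\sigma$ and $\tau$ agree on $I\setminus\Gamma$ then $\mathsf s_\sigma \mathsf c_{(\Gamma)}x=\mathsf s_\tau \mathsf c_{(\Gamma)}x$; if $\tau$ is injective on $\tau^{-1}\Gamma$ then $\mathsf c_{(\Gamma)}\mathsf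 s_\tau x=\mathsf s_\tau \mathsf c_{(\tau^{-1}\Gamma)}x$. For an ordinal $\alpha$, let $\mathbf{PA}_\alpha$ be the category of polyadic algebras with index set $\alpha$, with embeddings (injective homomorphisms) as morphisms. For $\alpha\le\beta$ and $B\in\mathbf{PA}_\beta$, the neat reduct $\mathrm{Nr}_\alpha B\in\mathbf{PA}_\alpha$ is the Boolean subalgebra $\{x\in B:\mathsf c_{(\beta\setminus\alpha)}x=x\}$ with the operations $\mathsf c_{(\Gamma)}$, $\Gamma\subseteq\alpha$, of $B$, and with $\mathsf s_\tau$, $\tau:\alpha\to\alpha$, given by the operation $\mathsf s_{\tau\cup\mathrm{Id}\restriction(\beta\setminus\alpha)}$ of $B$; on morphisms $\mathrm{Nr}_\alpha$ is restriction. An algebra $B\in\mathbf{PA}_\beta$ with an embedding $e:A\to\mathrm{Nr}_\alpha B$ is a minimal dilation of $A\in\mathbf{PA}_\alpha$ if $e(A)$ generates $B$. **Theorem.** Let $\alpha<\beta$ be infinite ordinals, and let $\mathbf L$ be the full subcategory of $\mathbf{PA}_\beta$ whose objects are the algebras $B$ generated by $\mathrm{Nr}_\alpha B$. Then the functor $\mathrm{Nr}_\alpha:\mathbf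 L\to\mathbf{PA}_\alpha$ is an equivalence of categories. More precisely, there are a functor $G:\mathbf{PA}_\alpha\to\mathbf L$ and natural isomorphisms $\mu:1_{\mathbf L}\to G\circ\mathrm{Nr}_\alpha$ and $\epsilon:\mathrm{Nr}_\alpha\circ G\to 1_{\mathbf{PA}_\alpha}$ such that 1. for each $A\in\mathbf{PA}_\alpha$, $G(A)$ with $\epsilon_A^{-1}:A\to\mathrm{Nr}_\alpha G(A)$ is a minimal dilation of $A$; 2. for each morphism $g:A\to A'$ of $\mathbf{PA}_\alpha$, $G(g)$ is the unique morphism $f:G(A)\to G(A')$ with $\mathrm{Nr}_\alpha(f)=\epsilon_{A'}^{-1}\circ g\circ\epsilon_A$; 3. for each $B\in\mathbf L$, $\mu_B$ is the unique morphism $f:B\to G(\mathrm{Nr}_\alpha B)$ with $\mathrm{Nr}_\alpha(f)=\epsilon_{\mathrm{Nr}_\alpha B}^{-1}$. -/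

import Mathlib

open CategoryTheory
open scoped Ordinal

universe u w

/-- Polyadic algebras (without equality) with index set `I`: a Boolean algebra with a cylindrifier
`c_(Γ)` for every `Γ ⊆ I` and a substitution `s_τ` for every transformation `τ` of `I`. -/
class PolyadicAlgebra (I : Type w) (A : Type u) [BooleanAlgebra A] where
  /-- the cylindrifier `c_(Γ)` -/
  cyl : Set I → A → A
  /-- the substitution `s_τ` -/
  sub : (I → I) → A → A
  cyl_bot : ∀ Γ, cyl Γ ⊥ = ⊥
  le_cyl : ∀ Γ x, x ≤ cyl Γ x
  cyl_inf_cyl : ∀ Γ x y, cyl Γ (x ⊓ cyl Γ y) = cyl Γ x ⊓ cyl Γ y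
  cyl_empty : ∀ x, cyl ∅ x = x
  cyl_cyl : ∀ Γ Δ x, cyl Γ (cyl Δ x) = cyl (Γ ∪ Δ) x
  sub_sup : ∀ τ x y, sub τ (x ⊔ y) = sub τ x ⊔ sub τ y
  sub_compl : ∀ τ x, sub τ xᶜ = (sub τ x)ᶜ
  sub_id : ∀ x, sub id x = x
  sub_comp : ∀ σ τ x, sub (σ ∘ τ) x = sub σ (sub τ x)
  sub_cyl_congr : ∀ (Γ : Set I) (σ τ : I → I), Set.EqOn σ τ Γᶜ →
    ∀ x, sub σ (cyl Γ x) = sub τ (cyl Γ x)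
  cyl_sub : ∀ (Γ : Set I) (τ : I → I), Set.InjOn τ (τ ⁻¹' Γ) →
    ∀ x, cyl Γ (sub τ x) = sub τ (cyl (τ ⁻¹' Γ) x)

namespace PolyadicAlgebra

section Basic

variable (I : Type w) {A : Type u} [BooleanAlgebra A] [PolyadicAlgebra I A]

/-- `S` is a subuniverse: closed under all operations of the polyadic algebra `A`. -/
structure IsSubuniverse (S : Set A) : Prop where
  bot_mem : ⊥ ∈ S
  top_mem : ⊤ ∈ S
  sup_mem : ∀ x ∈ S, ∀ y ∈ S, x ⊔ y ∈ S
  inf_mem : ∀ x ∈ S, ∀ y ∈ S, x ⊓ y ∈ S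
  compl_mem : ∀ x ∈ S, xᶜ ∈ S
  cyl_mem : ∀ (Γ : Set I), ∀ x ∈ S, cyl Γ x ∈ S
  sub_mem : ∀ (τ : I → I), ∀ x ∈ S, sub τ x ∈ S

/-- `Sg X`: the (universe of the) subalgebra generated by `X`. -/
def Sg (X : Set A) : Set A := ⋂₀ {S | IsSubuniverse I S ∧ X ⊆ S}

end Basic

section Closed

variable {I : Type w} {A : Type u} [BooleanAlgebra A] [PolyadicAlgebra I A]

theorem inf_closed {Γ : Set I} {x y : A} (hx : cyl Γ x = x) (hy : cyl Γ y = y) :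
    cyl Γ (x ⊓ y) = x ⊓ y := by
  have h := cyl_inf_cyl Γ x y
  rwa [hx, hy] at h

theorem compl_closed {Γ : Set I} {x : A} (hx : cyl Γ x = x) : cyl Γ xᶜ = xᶜ := by
  apply le_antisymm _ (le_cyl Γ xᶜ)
  have h := cyl_inf_cyl Γ xᶜ x
  rw [hx, inf_comm xᶜ x, inf_compl_self, cyl_bot] at h
  exact (disjoint_iff.mpr h.symm).le_compl_right

theorem sup_closed {Γ : Set I} {x y : A} (hx : cyl Γ x = x) (hy : cyl Γ y = y) :
    cyl Γ (x ⊔ y) = x ⊔ y := by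
  have h := compl_closed (inf_closed (compl_closed hx) (compl_closed hy))
  rwa [compl_inf, compl_compl, compl_compl] at h

end Closed

end PolyadicAlgebra

/-- Polyadic algebras with index set `I`, as the objects of a category. -/
structure PolyadicAlg (I : Type w) where
  carrier : Type u
  [boolean : BooleanAlgebra carrier]
  [polyadic : PolyadicAlgebra I carrier]

namespace PolyadicAlg

open PolyadicAlgebra

instance (I : Type w) : CoeSort (PolyadicAlg.{u, w} I) (Type u) := ⟨PolyadicAlg.carrier⟩

attribute [instance] PolyadicAlg.boolean PolyadicAlg.polyadic

/-- Embeddings: injective maps that preserve all operations. (A bounded lattice homomorphism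
between Boolean algebras preserves complements.) -/
@[ext]
structure Emb {I : Type w} (A B : PolyadicAlg.{u, w} I) where
  toHom : BoundedLatticeHom A B
  map_cyl : ∀ (Γ : Set I) (x : A), toHom (cyl Γ x) = cyl Γ (toHom x)
  map_sub : ∀ (τ : I → I) (x : A), toHom (sub τ x) = sub τ (toHom x)
  injective : Function.Injective toHom

/-- The category of polyadic algebras with index set `I` and embeddings. -/
instance (I : Type w) : Category (PolyadicAlg.{u, w} I) where
  Hom A B := Emb A B
  id A := ⟨BoundedLatticeHom.id A, fun _ _ => rfl, fun _ _ => rfl, fun _ _ h => h⟩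
  comp f g := ⟨g.toHom.comp f.toHom,
    fun Γ x => by simp [f.map_cyl, g.map_cyl], fun τ x => by simp [f.map_sub, g.map_sub],
    fun _ _ h => f.injective (g.injective h)⟩

end PolyadicAlg

/-- `PA_α`: polyadic algebras of dimension `α`, the index set being the set of ordinals below `α`;
the morphisms are the embeddings. -/
abbrev PA (α : Ordinal.{u}) := PolyadicAlg.{u, u + 1} (Set.Iio α)

namespace PA

open PolyadicAlgebra

variable {α β : Ordinal.{u}}

/-- `τ ∪ Id ↾ (β ∖ α)`: the extension of a transformation of `α` by the identity on `β ∖ α`. -/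
noncomputable def extendId (h : α ≤ β) (τ : Set.Iio α → Set.Iio α) : Set.Iio β → Set.Iio β :=
  open Classical in
  fun j => if hj : j.1 < α then Set.inclusion (Set.Iio_subset_Iio h) (τ ⟨j.1, hj⟩) else j

/-- `β ∖ α`, as a set of indices below `β`. -/
def extra (α β : Ordinal.{u}) : Set (Set.Iio β) := {j | α ≤ j.1}

/-- `Γ ⊆ α`, as a set of indices below `β`. -/
def lift (h : α ≤ β) (Γ : Set (Set.Iio α)) : Set (Set.Iio β) :=
  Set.inclusion (Set.Iio_subset_Iio h) '' Γ

theorem extendId_of_lt (h : α ≤ β) (τ : Set.Iio α → Set.Iio α) (j : Set.Iio β) (hj : j.1 < α) :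
    extendId h τ j = Set.inclusion (Set.Iio_subset_Iio h) (τ ⟨j.1, hj⟩) := dif_pos hj

theorem extendId_of_le (h : α ≤ β) (τ : Set.Iio α → Set.Iio α) (j : Set.Iio β) (hj : α ≤ j.1) :
    extendId h τ j = j := dif_neg hj.not_gt

theorem extendId_inclusion (h : α ≤ β) (τ : Set.Iio α → Set.Iio α) (i : Set.Iio α) :
    extendId h τ (Set.inclusion (Set.Iio_subset_Iio h) i) =
      Set.inclusion (Set.Iio_subset_Iio h) (τ i) := extendId_of_lt h τ _ i.2

theorem extendId_lt (h : α ≤ β) (τ : Set.Iio α → Set.Iio α) (j : Set.Iio β) (hj : j.1 < α) :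
    (extendId h τ j).1 < α := by
  rw [extendId_of_lt h τ j hj]
  exact (τ ⟨j.1, hj⟩).2

theorem extendId_id (h : α ≤ β) : extendId h id = id := by
  funext j
  rcases lt_or_ge j.1 α with hj | hj
  · rw [extendId_of_lt h _ j hj]; rfl
  · rw [extendId_of_le h _ j hj]; rfl

theorem extendId_comp (h : α ≤ β) (σ τ : Set.Iio α → Set.Iio α) :
    extendId h (σ ∘ τ) = extendId h σ ∘ extendId h τ := by
  funext j
  rcases lt_or_ge j.1 α with hj | hj
  · rw [Function.comp_apply, extendId_of_lt h _ j hj, extendId_of_lt h τ j hj,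
      extendId_inclusion]; rfl
  · rw [Function.comp_apply, extendId_of_le h _ j hj, extendId_of_le h τ j hj,
      extendId_of_le h σ j hj]

theorem preimage_extra (h : α ≤ β) (τ : Set.Iio α → Set.Iio α) :
    extendId h τ ⁻¹' extra α β = extra α β := by
  ext j
  rcases lt_or_ge j.1 α with hj | hj
  · exact ⟨fun h' => absurd (extendId_lt h τ j hj) (not_lt.mpr h'), fun h' => absurd hj h'.not_gt⟩
  · simp [extendId_of_le h τ j hj]

theorem preimage_lift (h : α ≤ β) (τ : Set.Iio α → Set.Iio α) (Γ : Set (Set.Iio α)) :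
    extendId h τ ⁻¹' lift h Γ = lift h (τ ⁻¹' Γ) := by
  ext j
  constructor
  · rintro ⟨i, hi, hij⟩
    have hj : j.1 < α := by
      by_contra hj
      rw [extendId_of_le h τ j (not_lt.mp hj)] at hij
      exact hj (hij ▸ i.2)
    rw [extendId_of_lt h τ j hj] at hij
    have := Set.inclusion_injective _ hij
    exact ⟨⟨j.1, hj⟩, by simpa [← this] using hi, rfl⟩
  · rintro ⟨i, hi, rfl⟩
    exact ⟨τ i, hi, (extendId_inclusion h τ i).symm⟩

/-- The Boolean part of the neat `α`-reduct of `B`: the elements `x` with `c_(β ∖ α) x = x`. -/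
def neatSubalgebra (α : Ordinal.{u}) (B : PA β) : BooleanSubalgebra B where
  carrier := {x | cyl (extra α β) x = x}
  supClosed' := fun _ hx _ hy => sup_closed hx hy
  infClosed' := fun _ hx _ hy => inf_closed hx hy
  compl_mem' := fun hx => compl_closed hx
  bot_mem' := cyl_bot _

/-- The polyadic operations of the neat `α`-reduct: `c_(Γ)` for `Γ ⊆ α` as in `B`, and `s_τ` for
`τ : α → α` given by the substitution `s_{τ ∪ Id ↾ (β ∖ α)}` of `B`. -/
noncomputable abbrev neatPolyadic (h : α ≤ β) (B : PA β) :
    PolyadicAlgebra (Set.Iio α) (neatSubalgebra α B) where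
  cyl Γ x := ⟨cyl (lift h Γ) x.1, by
    change cyl (extra α β) (cyl (lift h Γ) x.1) = cyl (lift h Γ) x.1
    have hx : cyl (extra α β) x.1 = x.1 := x.2
    rw [cyl_cyl, Set.union_comm, ← cyl_cyl, hx]⟩
  sub τ x := ⟨sub (extendId h τ) x.1, by
    change cyl (extra α β) (sub (extendId h τ) x.1) = sub (extendId h τ) x.1
    have hx : cyl (extra α β) x.1 = x.1 := x.2
    rw [cyl_sub, preimage_extra, hx]
    rw [preimage_extra]
    intro i hi j hj hij
    rwa [extendId_of_le h τ i hi, extendId_of_le h τ j hj] at hij⟩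
  cyl_bot _ := Subtype.ext (cyl_bot _)
  le_cyl _ _ := le_cyl (I := Set.Iio β) _ _
  cyl_inf_cyl _ _ _ := Subtype.ext (cyl_inf_cyl _ _ _)
  cyl_empty x := Subtype.ext (by simp [lift, cyl_empty])
  cyl_cyl _ _ _ := Subtype.ext (by simp [lift, cyl_cyl, Set.image_union])
  sub_sup _ _ _ := Subtype.ext (sub_sup _ _ _)
  sub_compl _ _ := Subtype.ext (sub_compl _ _)
  sub_id _ := Subtype.ext (by simp [extendId_id, sub_id])
  sub_comp _ _ _ := Subtype.ext (by simp [extendId_comp, sub_comp])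
  sub_cyl_congr Γ σ τ hστ x := Subtype.ext (by
    refine sub_cyl_congr (lift h Γ) _ _ ?_ x.1
    intro j hj
    rcases lt_or_ge j.1 α with hj' | hj'
    · rw [extendId_of_lt h σ j hj', extendId_of_lt h τ j hj', hστ]
      exact fun hmem => hj ⟨_, hmem, rfl⟩
    · rw [extendId_of_le h σ j hj', extendId_of_le h τ j hj'])
  cyl_sub Γ τ hτ x := Subtype.ext (by
    refine (cyl_sub (lift h Γ) (extendId h τ) ?_ x.1).trans ?_
    · rw [preimage_lift]
      rintro _ ⟨i, hi, rfl⟩ _ ⟨j, hj, rfl⟩ hij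
      rw [extendId_inclusion, extendId_inclusion] at hij
      rw [hτ hi hj (Set.inclusion_injective _ hij)]
    · rw [preimage_lift])

/-- The neat `α`-reduct `Nr_α B` of a polyadic algebra `B` of dimension `β ≥ α`. -/
noncomputable def neatReduct (h : α ≤ β) (B : PA β) : PA α :=
  letI := neatPolyadic h B
  ⟨neatSubalgebra α B⟩

/-- The neat reduct functor on all of `PA_β`: embeddings are restricted to the neat reducts. -/
noncomputable def neatReductFunctor (h : α ≤ β) : PA β ⥤ PA α where
  obj B := neatReduct h B
  map {B B'} f :=
    { toHom :=
        { toFun := fun x => (⟨f.toHom x.1, by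
            change cyl (extra α β) (f.toHom x.1) = f.toHom x.1
            rw [← f.map_cyl]
            exact congrArg f.toHom x.2⟩ : neatSubalgebra α B')
          map_sup' := fun _ _ => Subtype.ext (map_sup f.toHom _ _)
          map_inf' := fun _ _ => Subtype.ext (map_inf f.toHom _ _)
          map_top' := Subtype.ext (map_top f.toHom)
          map_bot' := Subtype.ext (map_bot f.toHom) }
      map_cyl := fun _ _ => Subtype.ext (f.map_cyl _ _)
      map_sub := fun _ _ => Subtype.ext (f.map_sub _ _)
      injective := fun _ _ hxy => Subtype.ext (f.injective (congrArg Subtype.val hxy)) }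
  map_id _ := rfl
  map_comp _ _ := rfl

/-- `B` is generated by its neat `α`-reduct: `B = Sg^B Nr_α B`. -/
def generatedByNeat (α β : Ordinal.{u}) : ObjectProperty (PA β) :=
  fun B => Sg (Set.Iio β) (neatSubalgebra α B : Set B) = Set.univ

/-- The category `L` of the polyadic algebras of dimension `β` that are generated by their neat
`α`-reduct, with embeddings as morphisms. -/
abbrev NeatlyGenerated (α β : Ordinal.{u}) := (generatedByNeat α β).FullSubcategory

/-- The neat reduct functor `Nr_α : L → PA_α`. -/
noncomputable def Nr (h : α ≤ β) : NeatlyGenerated α β ⥤ PA α :=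
  (generatedByNeat α β).ι ⋙ neatReductFunctor h

/-- `B` is a minimal dilation of `A` along the embedding `e : A → Nr_α B`: the image of `A`
generates `B`. -/
def IsMinimalDilation (h : α ≤ β) {A : PA α} {B : PA β} (e : A ⟶ neatReduct h B) : Prop :=
  Sg (Set.Iio β) {b : B | ∃ a : A, (show neatSubalgebra α B from e.toHom a).1 = b} = Set.univ

end PA

/-! Every element of a minimal dilation of `A` should have the form `s_ρ a` with `a ∈ A` and `ρ : α
→ β`. As `α` is infinite, the ranges of two such maps together have at most `|α|` elements, so both
maps factor through one injection `π : α → β` (`exists_common_injection`). Hence any two elements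
are `s_π a` and `s_π b` for the same injective `π`, and the rule `c_(Γ) s_π a = s_π c_(π⁻¹Γ) a` then
leaves no choice for the cylindrifiers.

Existence: `s_ρ a` is modelled by the function `θ ↦ s_(θ ∘ ρ) a` on the maps `θ : β → α`; `Shrink`
keeps these functions in the universe of `A`. Boolean operations are pointwise, substitutions act on
the argument, and `mk_cyl_congr` makes the cylindrifiers well defined. By `exists_eq_mk_of_cyl_eq`
the neat reduct is no larger than `A`.

Uniqueness: if `Nr_α B` generates `B`, the elements `s_σ b` with `b` neat form a subuniverse, by
`cyl_sub_of_neat`, so they exhaust `B`. Then `x ↦ (θ ↦ s_θ x)` identifies `B` with the dilation of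
`Nr_α B`, and an embedding is determined by its restriction to the neat reduct. -/

namespace PolyadicAlgebra

/-! ### Consequences of the axioms -/

section Basic

variable {I : Type w} {A : Type u} [BooleanAlgebra A] [PolyadicAlgebra I A]

/-- Since `⊥ ≤ ⊤` and complements are preserved, `s_τ ⊥` lies below its own complement. -/
theorem sub_bot (τ : I → I) : sub τ (⊥ : A) = ⊥ := by
  have h1 := sub_sup τ (⊥ : A) ⊤
  have h2 := sub_compl τ (⊥ : A)
  rw [bot_sup_eq] at h1
  rw [compl_bot] at h2
  rw [h2] at h1
  have h3 : sub τ (⊥ : A) ≤ (sub τ (⊥ : A))ᶜ := by rw [h1]; exact le_sup_left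
  exact le_bot_iff.mp ((le_inf le_rfl h3).trans (inf_compl_self _).le)

theorem sub_inf (τ : I → I) (x y : A) : sub τ (x ⊓ y) = sub τ x ⊓ sub τ y := by
  rw [← compl_compl (x ⊓ y), compl_inf, sub_compl, sub_sup, sub_compl, sub_compl, compl_sup,
    compl_compl, compl_compl]

theorem sub_top (τ : I → I) : sub τ (⊤ : A) = ⊤ := by
  rw [← compl_bot, sub_compl, sub_bot]

theorem sub_mono (τ : I → I) {x y : A} (h : x ≤ y) : sub τ x ≤ sub τ y := by
  rw [← inf_eq_left] at h ⊢
  rw [← sub_inf, h]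

theorem cyl_idem (Γ : Set I) (x : A) : cyl Γ (cyl Γ x) = cyl Γ x := by
  rw [cyl_cyl, Set.union_self]

theorem cyl_mono (Γ : Set I) {x y : A} (h : x ≤ y) : cyl Γ x ≤ cyl Γ y := by
  have h1 := cyl_inf_cyl Γ x y
  rw [inf_eq_left.mpr (h.trans (le_cyl Γ y))] at h1
  exact inf_eq_left.mp h1.symm

end Basic

/-- Two maps from an infinite set factor through a common injection. -/
theorem exists_common_injection {I J : Type w} [Infinite I] (ι : I ↪ J) (ρ₁ ρ₂ : I → J) :
    ∃ (π : I → J) (θ₁ θ₂ : I → I), Function.Injective π ∧ ρ₁ = π ∘ θ₁ ∧ ρ₂ = π ∘ θ₂ := by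
  -- Including the range of `ι` forces `X` to have at least as many elements as `I`.
  let X : Set J := Set.range ι ∪ (Set.range ρ₁ ∪ Set.range ρ₂)
  have hI : Cardinal.aleph0 ≤ Cardinal.mk I := Cardinal.aleph0_le_mk I
  have hX : Cardinal.mk X = Cardinal.mk I := by
    apply le_antisymm
    · refine (Cardinal.mk_union_le _ _).trans (Cardinal.add_le_of_le hI Cardinal.mk_range_le ?_)
      exact (Cardinal.mk_union_le _ _).trans
        (Cardinal.add_le_of_le hI Cardinal.mk_range_le Cardinal.mk_range_le)
    · exact Cardinal.mk_le_of_injective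
        (f := fun i => (⟨ι i, Or.inl ⟨i, rfl⟩⟩ : X))
        (fun i j h => ι.injective (congrArg Subtype.val h))
  obtain ⟨e⟩ := Cardinal.eq.mp hX
  refine ⟨fun i => (e.symm i).1, fun i => e ⟨ρ₁ i, Or.inr (Or.inl ⟨i, rfl⟩)⟩,
    fun i => e ⟨ρ₂ i, Or.inr (Or.inr ⟨i, rfl⟩)⟩,
    Subtype.val_injective.comp e.symm.injective, ?_, ?_⟩ <;> funext i <;> simp

/-! ### The dilation as an algebra of functions -/

section Dilation

variable {I J : Type w} {A : Type u} [BooleanAlgebra A] [PolyadicAlgebra I A] [Small.{u} (J → I)]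

/-- The function `θ ↦ s_(θ ∘ ρ) a` on the maps `θ : J → I`. It stands for the result of substituting
`ρ` into `a` in a dilation. -/
noncomputable def transported (ρ : I → J) (a : A) : Shrink.{u} (J → I) → A :=
  fun t => sub ((equivShrink (J → I)).symm t ∘ ρ) a

theorem transported_comp (ρ : I → J) (θ : I → I) (a : A) :
    transported (ρ ∘ θ) a = transported ρ (sub θ a) := by
  funext t
  simp only [transported, ← sub_comp, Function.comp_assoc]

/-- Evaluation at a left inverse of `ρ` recovers `a`. -/
theorem transported_injective [Nonempty I] {ρ : I → J} (hρ : Function.Injective ρ) :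
    Function.Injective (transported ρ : A → _) := by
  intro a b h
  have h' := congrFun h (equivShrink _ (Function.invFun ρ))
  simpa only [transported, Equiv.symm_apply_apply, Function.invFun_comp hρ, sub_id] using h'

theorem transported_sup (ρ : I → J) (a b : A) :
    transported ρ (a ⊔ b) = transported ρ a ⊔ transported ρ b := funext fun _ => sub_sup _ _ _

theorem transported_inf (ρ : I → J) (a b : A) :
    transported ρ (a ⊓ b) = transported ρ a ⊓ transported ρ b := funext fun _ => sub_inf _ _ _

theorem transported_compl (ρ : I → J) (a : A) :
    transported ρ aᶜ = (transported ρ a)ᶜ := funext fun _ => sub_compl _ _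

theorem transported_bot (ρ : I → J) : transported ρ (⊥ : A) = ⊥ := funext fun _ => sub_bot _

theorem transported_top (ρ : I → J) : transported ρ (⊤ : A) = ⊤ := funext fun _ => sub_top _

variable [Infinite I] (ι : I ↪ J) (A)

/-- The dilation of `A` to the index set `J`, as a Boolean algebra. -/
noncomputable def dilation : BooleanSubalgebra (Shrink.{u} (J → I) → A) where
  carrier := {f | ∃ (ρ : I → J) (a : A), f = transported ρ a}
  supClosed' := by
    rintro _ ⟨ρ₁, a, rfl⟩ _ ⟨ρ₂, b, rfl⟩
    obtain ⟨π, θ₁, θ₂, -, rfl, rfl⟩ := exists_common_injection ι ρ₁ ρ₂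
    exact ⟨π, sub θ₁ a ⊔ sub θ₂ b, by rw [transported_sup, transported_comp, transported_comp]⟩
  infClosed' := by
    rintro _ ⟨ρ₁, a, rfl⟩ _ ⟨ρ₂, b, rfl⟩
    obtain ⟨π, θ₁, θ₂, -, rfl, rfl⟩ := exists_common_injection ι ρ₁ ρ₂
    exact ⟨π, sub θ₁ a ⊓ sub θ₂ b, by rw [transported_inf, transported_comp, transported_comp]⟩
  compl_mem' := by
    rintro _ ⟨ρ, a, rfl⟩
    exact ⟨ρ, aᶜ, (transported_compl ρ a).symm⟩
  bot_mem' := ⟨ι, ⊥, (transported_bot _).symm⟩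

namespace dilation

variable {A}

/-- The element `s_ρ a` of the dilation. -/
noncomputable def mk (ρ : I → J) (a : A) : dilation A ι := ⟨transported ρ a, ρ, a, rfl⟩

theorem mk_comp (ρ : I → J) (θ : I → I) (a : A) : mk ι (ρ ∘ θ) a = mk ι ρ (sub θ a) :=
  Subtype.ext (transported_comp ρ θ a)

theorem mk_injective {ρ : I → J} (hρ : Function.Injective ρ) :
    Function.Injective (mk ι ρ : A → _) :=
  fun _ _ h => transported_injective hρ (congrArg Subtype.val h)

theorem mk_sup (ρ : I → J) (a b : A) : mk ι ρ (a ⊔ b) = mk ι ρ a ⊔ mk ι ρ b :=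
  Subtype.ext (transported_sup ρ a b)

theorem mk_inf (ρ : I → J) (a b : A) : mk ι ρ (a ⊓ b) = mk ι ρ a ⊓ mk ι ρ b :=
  Subtype.ext (transported_inf ρ a b)

theorem mk_bot (ρ : I → J) : mk ι ρ (⊥ : A) = ⊥ := Subtype.ext (transported_bot ρ)

theorem mk_top (ρ : I → J) : mk ι ρ (⊤ : A) = ⊤ := Subtype.ext (transported_top ρ)

/-- A common injective `π` reduces identities between two elements to identities in `A`. -/
theorem exists_mk₂ (x y : dilation A ι) : ∃ (π : I → J) (a b : A),
    Function.Injective π ∧ x = mk ι π a ∧ y = mk ι π b := by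
  obtain ⟨_, ρ₁, a, rfl⟩ := x
  obtain ⟨_, ρ₂, b, rfl⟩ := y
  obtain ⟨π, θ₁, θ₂, hπ, rfl, rfl⟩ := exists_common_injection ι ρ₁ ρ₂
  exact ⟨π, _, _, hπ, mk_comp ι π θ₁ a, mk_comp ι π θ₂ b⟩

theorem exists_mk (x : dilation A ι) :
    ∃ p : (I → J) × A, Function.Injective p.1 ∧ x = mk ι p.1 p.2 := by
  obtain ⟨π, a, -, hπ, hx, -⟩ := exists_mk₂ ι x x
  exact ⟨(π, a), hπ, hx⟩

/-- With `ρᵢ = π ∘ θᵢ` the maps `θᵢ` are injective, so `cyl_sub` in `A` turns both sides into `s_π`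
of the `π⁻¹Γ`-cylinder of one and the same element. -/
theorem mk_cyl_congr {ρ₁ ρ₂ : I → J} (h₁ : Function.Injective ρ₁) (h₂ : Function.Injective ρ₂)
    {a b : A} (h : mk ι ρ₁ a = mk ι ρ₂ b) (Γ : Set J) :
    mk ι ρ₁ (cyl (ρ₁ ⁻¹' Γ) a) = mk ι ρ₂ (cyl (ρ₂ ⁻¹' Γ) b) := by
  obtain ⟨π, θ₁, θ₂, hπ, rfl, rfl⟩ := exists_common_injection ι ρ₁ ρ₂
  rw [mk_comp, mk_comp] at h ⊢
  rw [Set.preimage_comp, Set.preimage_comp, ← cyl_sub _ _ h₁.of_comp.injOn,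
    ← cyl_sub _ _ h₂.of_comp.injOn, mk_injective ι hπ h]

/-- The cylindrifiers of the dilation. -/
noncomputable def cylinder (Γ : Set J) (x : dilation A ι) : dilation A ι :=
  mk ι (exists_mk ι x).choose.1
    (cyl ((exists_mk ι x).choose.1 ⁻¹' Γ) (exists_mk ι x).choose.2)

theorem cylinder_mk (Γ : Set J) {ρ : I → J} (hρ : Function.Injective ρ) (a : A) :
    cylinder ι Γ (mk ι ρ a) = mk ι ρ (cyl (ρ ⁻¹' Γ) a) :=
  mk_cyl_congr ι (exists_mk ι (mk ι ρ a)).choose_spec.1 hρ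
    (exists_mk ι (mk ι ρ a)).choose_spec.2.symm Γ

/-- The substitutions of the dilation. -/
noncomputable def subst (τ : J → J) (x : dilation A ι) : dilation A ι :=
  ⟨fun t => x.1 (equivShrink _ ((equivShrink (J → I)).symm t ∘ τ)), by
    obtain ⟨_, ρ, a, rfl⟩ := x
    refine ⟨τ ∘ ρ, a, funext fun t => ?_⟩
    simp only [transported, Equiv.symm_apply_apply, Function.comp_assoc]⟩

theorem subst_mk (τ : J → J) (ρ : I → J) (a : A) : subst ι τ (mk ι ρ a) = mk ι (τ ∘ ρ) a := by
  refine Subtype.ext (funext fun t => ?_)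
  simp only [subst, mk, transported, Equiv.symm_apply_apply, Function.comp_assoc]

noncomputable instance : PolyadicAlgebra J (dilation A ι) where
  cyl := cylinder ι
  sub := subst ι
  cyl_bot Γ := by
    rw [← mk_bot ι ι, cylinder_mk ι Γ ι.injective, cyl_bot]
  le_cyl Γ x := by
    obtain ⟨⟨ρ, a⟩, hρ, rfl⟩ := exists_mk ι x
    rw [cylinder_mk ι Γ hρ, ← inf_eq_left, ← mk_inf, inf_eq_left.mpr (le_cyl _ _)]
  cyl_inf_cyl Γ x y := by
    obtain ⟨ρ, a, b, hρ, rfl, rfl⟩ := exists_mk₂ ι x y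
    simp only [cylinder_mk ι Γ hρ, ← mk_inf, cyl_inf_cyl]
  cyl_empty x := by
    obtain ⟨⟨ρ, a⟩, hρ, rfl⟩ := exists_mk ι x
    rw [cylinder_mk ι _ hρ, Set.preimage_empty, cyl_empty]
  cyl_cyl Γ Δ x := by
    obtain ⟨⟨ρ, a⟩, hρ, rfl⟩ := exists_mk ι x
    simp only [cylinder_mk ι _ hρ, cyl_cyl, Set.preimage_union]
  sub_sup _ _ _ := rfl
  sub_compl _ _ := rfl
  sub_id x := Subtype.ext (funext fun t => by
    simp only [subst, Function.comp_id, Equiv.apply_symm_apply])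
  sub_comp σ τ x := Subtype.ext (funext fun t => by
    simp only [subst, Equiv.symm_apply_apply, Function.comp_assoc])
  sub_cyl_congr Γ σ τ h x := by
    obtain ⟨⟨ρ, a⟩, hρ, rfl⟩ := exists_mk ι x
    rw [cylinder_mk ι _ hρ, subst_mk, subst_mk]
    -- At each `θ : J → I`, the maps `θ ∘ σ ∘ ρ` and `θ ∘ τ ∘ ρ` agree off `ρ⁻¹Γ`, so the axiom of
    -- `A` applies pointwise.
    refine Subtype.ext (funext fun t => sub_cyl_congr _ _ _ (fun i hi => ?_) a)
    exact congrArg ((equivShrink (J → I)).symm t) (h hi)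
  cyl_sub Γ τ hτ x := by
    obtain ⟨⟨ρ, a⟩, hρ, rfl⟩ := exists_mk ι x
    -- `τ ∘ ρ` need not be injective. Its non-injective part is moved into `θ`, which acts inside
    -- `A` and is still injective over `π⁻¹Γ`.
    obtain ⟨π, θ, -, hπ, hθ, -⟩ := exists_common_injection ι (τ ∘ ρ) (τ ∘ ρ)
    have hpre : ρ ⁻¹' (τ ⁻¹' Γ) = θ ⁻¹' (π ⁻¹' Γ) := by
      rw [← Set.preimage_comp, ← Set.preimage_comp, hθ]
    have hinj : Set.InjOn θ (θ ⁻¹' (π ⁻¹' Γ)) := by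
      rw [← hpre]
      intro i hi j hj hij
      refine hρ (hτ hi hj ?_)
      change (τ ∘ ρ) i = (τ ∘ ρ) j
      rw [hθ, Function.comp_apply, hij, Function.comp_apply]
    rw [cylinder_mk ι _ hρ, subst_mk, subst_mk, hθ, mk_comp, cylinder_mk ι _ hπ,
      cyl_sub _ _ hinj, mk_comp, hpre]

theorem cyl_mk (Γ : Set J) {ρ : I → J} (hρ : Function.Injective ρ) (a : A) :
    cyl Γ (mk ι ρ a) = mk ι ρ (cyl (ρ ⁻¹' Γ) a) := cylinder_mk ι Γ hρ a

theorem sub_mk (τ : J → J) (ρ : I → J) (a : A) : sub τ (mk ι ρ a) = mk ι (τ ∘ ρ) a :=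
  subst_mk ι τ ρ a

/-- An element that does not depend on the indices outside the range of `ι` comes from `A`. -/
theorem exists_eq_mk_of_cyl_eq {x : dilation A ι} (hx : cyl (Set.range ι)ᶜ x = x) :
    ∃ a : A, x = mk ι ι a := by
  obtain ⟨⟨ρ₀, a₀⟩, -, rfl⟩ := exists_mk ι x
  obtain ⟨π, θ, θ', hπ, rfl, hι⟩ := exists_common_injection ι ρ₀ ι
  simp only [mk_comp] at hx ⊢
  generalize sub θ a₀ = a at hx ⊢
  rw [cyl_mk ι _ hπ] at hx
  have ha := mk_injective ι hπ hx
  have hθ' : Function.Injective θ' := by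
    refine Function.Injective.of_comp (f := π) ?_
    rw [← hι]
    exact ι.injective
  -- By `ha`, `a` depends only on indices in the range of `θ'`, and there `θ' ∘ invFun θ'` is the
  -- identity.
  refine ⟨sub (Function.invFun θ') a, ?_⟩
  conv_rhs => rw [hι]
  rw [mk_comp, ← sub_comp, ← ha, sub_cyl_congr _ _ id, sub_id]
  intro i hi
  have hi' : π i ∈ Set.range ι := by simpa using hi
  obtain ⟨k, hk⟩ := hi'
  rw [hι] at hk
  have hk' : θ' k = i := hπ hk
  subst hk'
  simp only [Function.comp_apply, id, Function.leftInverse_invFun hθ' k]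

end dilation

end Dilation

end PolyadicAlgebra

/-! ### Surjective embeddings are isomorphisms -/

namespace PolyadicAlg

open PolyadicAlgebra

section

variable {I : Type w}

theorem hom_ext {A B : PolyadicAlg.{u, w} I} {f g : A ⟶ B} (h : ∀ x, f.toHom x = g.toHom x) :
    f = g :=
  Emb.ext (DFunLike.ext _ _ h)

theorem toHom_surjInv {A B : PolyadicAlg.{u, w} I} (f : A ⟶ B)
    (hf : Function.Surjective f.toHom) (y : B) : f.toHom (Function.surjInv hf y) = y :=
  Function.surjInv_eq hf y

/-- The inverse of a surjective embedding. -/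
noncomputable def invOfSurjective {A B : PolyadicAlg.{u, w} I} (f : A ⟶ B)
    (hf : Function.Surjective f.toHom) : B ⟶ A where
  toHom :=
    { toFun := Function.surjInv hf
      map_sup' := fun x y => f.injective <| by
        rw [map_sup, toHom_surjInv f hf, toHom_surjInv f hf, toHom_surjInv f hf]
      map_inf' := fun x y => f.injective <| by
        rw [map_inf, toHom_surjInv f hf, toHom_surjInv f hf, toHom_surjInv f hf]
      map_top' := f.injective <| by rw [map_top, toHom_surjInv f hf]
      map_bot' := f.injective <| by rw [map_bot, toHom_surjInv f hf] }
  map_cyl Γ x := f.injective <| by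
    change f.toHom (Function.surjInv hf _) = f.toHom (cyl Γ (Function.surjInv hf x))
    rw [f.map_cyl, toHom_surjInv f hf, toHom_surjInv f hf]
  map_sub τ x := f.injective <| by
    change f.toHom (Function.surjInv hf _) = f.toHom (sub τ (Function.surjInv hf x))
    rw [f.map_sub, toHom_surjInv f hf, toHom_surjInv f hf]
  injective := Function.injective_surjInv hf

/-- A surjective embedding is an isomorphism. -/
noncomputable def isoOfSurjective {A B : PolyadicAlg.{u, w} I} (f : A ⟶ B)
    (hf : Function.Surjective f.toHom) : A ≅ B where
  hom := f
  inv := invOfSurjective f hf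
  hom_inv_id := hom_ext fun _ => f.injective (toHom_surjInv f hf _)
  inv_hom_id := hom_ext fun x => toHom_surjInv f hf x

end

end PolyadicAlg

/-! ### Indices below `α` and below `β` -/

namespace PA

open PolyadicAlgebra PolyadicAlg

variable {α β : Ordinal.{u}}

/-- The inclusion of the indices below `α` into those below `β`. -/
def incl (h : α ≤ β) : Set.Iio α ↪ Set.Iio β :=
  ⟨Set.inclusion (Set.Iio_subset_Iio h), Set.inclusion_injective _⟩

theorem compl_extra (h : α ≤ β) : (extra α β)ᶜ = Set.range (incl h) := by
  ext j
  constructor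
  · exact fun hj => ⟨⟨j.1, lt_of_not_ge (a := j.1) (b := α) hj⟩, rfl⟩
  · rintro ⟨i, rfl⟩
    exact not_le_of_gt (Set.mem_Iio.mp i.2)

theorem compl_range_incl (h : α ≤ β) : (Set.range (incl h))ᶜ = extra α β := by
  rw [← compl_extra, compl_compl]

theorem preimage_incl_lift (h : α ≤ β) (Γ : Set (Set.Iio α)) : incl h ⁻¹' lift h Γ = Γ :=
  Set.preimage_image_eq _ (incl h).injective

theorem extendId_comp_incl (h : α ≤ β) (τ : Set.Iio α → Set.Iio α) :
    extendId h τ ∘ incl h = incl h ∘ τ := funext (extendId_inclusion h τ)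

/-- The value `j` on `β ∖ α` is free because neat elements do not depend on it; `cyl_sub_of_neat`
takes it outside `Γ`. -/
theorem exists_extension (h : α ≤ β) (ρ : Set.Iio α → Set.Iio β) (j : Set.Iio β) :
    ∃ σ : Set.Iio β → Set.Iio β, σ ∘ incl h = ρ ∧ ∀ k ∈ extra α β, σ k = j := by
  refine ⟨Function.extend (incl h) ρ fun _ => j,
    funext fun i => (incl h).injective.extend_apply _ _ i,
    fun k hk => Function.extend_apply' _ _ _ ?_⟩
  rintro ⟨i, rfl⟩
  exact (compl_extra h).symm.subset ⟨i, rfl⟩ hk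

/-! ### Substitution instances of neat elements -/

section Neat

variable {B : PA β}

/-- A neat element is its own `c_(β ∖ α)`, so only the values of a substitution on `α` matter. -/
theorem sub_congr_of_neat (h : α ≤ β) {b : B} (hb : b ∈ neatSubalgebra α B)
    {σ τ : Set.Iio β → Set.Iio β} (hστ : σ ∘ incl h = τ ∘ incl h) : sub σ b = sub τ b := by
  have hb' : cyl (extra α β) b = b := hb
  rw [← hb']
  refine sub_cyl_congr _ _ _ (fun j hj => ?_) b
  rw [compl_extra h] at hj
  obtain ⟨i, rfl⟩ := hj
  exact congrFun hστ i

theorem cyl_mem_neat (h : α ≤ β) {b : B} (hb : b ∈ neatSubalgebra α B) (Γ : Set (Set.Iio α)) :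
    cyl (lift h Γ) b ∈ neatSubalgebra α B :=
  letI := neatPolyadic h B
  (cyl Γ (⟨b, hb⟩ : neatSubalgebra α B)).2

theorem sub_extendId_mem_neat (h : α ≤ β) {b : B} (hb : b ∈ neatSubalgebra α B)
    (τ : Set.Iio α → Set.Iio α) : sub (extendId h τ) b ∈ neatSubalgebra α B :=
  letI := neatPolyadic h B
  (sub τ (⟨b, hb⟩ : neatSubalgebra α B)).2

/-- Cylindrification commutes with substitutions that are injective below `α`. -/
theorem cyl_sub_of_neat (h : α ≤ β) {b : B} (hb : b ∈ neatSubalgebra α B)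
    {σ : Set.Iio β → Set.Iio β} (hσ : Function.Injective (σ ∘ incl h)) (Γ : Set (Set.Iio β)) :
    cyl Γ (sub σ b) = sub σ (cyl (lift h ((σ ∘ incl h) ⁻¹' Γ)) b) := by
  by_cases hΓ : Γ = Set.univ
  -- No index lies outside `Γ`, so `β ∖ α` cannot be sent away from it. Instead, elements closed
  -- under `c_(β)` are fixed by every substitution, and two inequalities are compared.
  · subst hΓ
    have hb' : cyl (extra α β) b = b := hb
    have huniv : cyl (lift h ((σ ∘ incl h) ⁻¹' Set.univ)) b =
        cyl (Set.univ : Set (Set.Iio β)) b := by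
      rw [show cyl (lift h ((σ ∘ incl h) ⁻¹' Set.univ)) b =
        cyl (lift h ((σ ∘ incl h) ⁻¹' Set.univ)) (cyl (extra α β) b) from
        congrArg (cyl (lift h _)) hb'.symm]
      rw [cyl_cyl (lift h _), Set.preimage_univ, lift, Set.image_univ, ← Set.compl_union_self (extra α β),
        compl_extra h]
      rfl
    have hfix : ∀ τ : Set.Iio β → Set.Iio β, sub τ (cyl Set.univ b) = cyl Set.univ b := fun τ => by
      rw [sub_cyl_congr Set.univ τ id (fun _ hj => absurd (Set.mem_univ _) hj), sub_id]
    rw [huniv, hfix]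
    apply le_antisymm
    · rw [← cyl_idem Set.univ b]
      refine cyl_mono _ ?_
      rw [← hfix σ]
      exact sub_mono σ (le_cyl _ _)
    · rcases isEmpty_or_nonempty (Set.Iio α) with hα | hα
      · have : sub σ b = b := by
          rw [sub_congr_of_neat h hb (τ := id) (funext fun i => hα.elim i), sub_id]
        rw [this]
      -- A left inverse on `α` gives `b = s_δ s_σ b ≤ s_δ c_(β) s_σ b = c_(β) s_σ b`.
      · have hδ : sub (incl h ∘ Function.invFun (σ ∘ incl h)) (sub σ b) = b := by
          rw [← sub_comp, sub_congr_of_neat h hb (τ := id), sub_id]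
          funext i
          exact congrArg (incl h) (Function.leftInverse_invFun hσ i)
        rw [← cyl_idem Set.univ (sub σ b)]
        refine cyl_mono _ ?_
        conv_lhs => rw [← hδ]
        have hfix' := sub_cyl_congr Set.univ (incl h ∘ Function.invFun (σ ∘ incl h)) id
          (fun _ hj => absurd (Set.mem_univ _) hj) (sub σ b)
        rw [sub_id] at hfix'
        rw [← hfix']
        exact sub_mono _ (le_cyl _ _)
  · obtain ⟨j, hj⟩ := (Set.ne_univ_iff_exists_notMem Γ).mp hΓ
    -- Replacing `σ` by a map that sends `β ∖ α` to `j ∉ Γ` puts the preimage of `Γ` inside `α`,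
    -- where the map is injective; the axiom then applies.
    obtain ⟨τ, hτ, hτj⟩ := exists_extension h (σ ∘ incl h) j
    rw [sub_congr_of_neat h hb hτ.symm, sub_congr_of_neat h (cyl_mem_neat h hb _) hτ.symm, ← hτ]
    have hpre : τ ⁻¹' Γ = lift h ((τ ∘ incl h) ⁻¹' Γ) := by
      ext k
      constructor
      · intro hk
        have hk' : k ∈ (extra α β)ᶜ := fun hk' => hj (hτj k hk' ▸ hk)
        rw [compl_extra h] at hk'
        obtain ⟨i, rfl⟩ := hk'
        exact ⟨i, hk, rfl⟩
      · rintro ⟨i, hi, rfl⟩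
        exact hi
    rw [← hpre, cyl_sub]
    rw [hpre]
    rintro _ ⟨i, -, rfl⟩ _ ⟨k, -, rfl⟩ hik
    rw [← hτ] at hσ
    rw [hσ hik]

/-- The substitution takes no value in `β ∖ α`, so `c_(β ∖ α)` passes through it as `c_(∅)`. -/
theorem sub_incl_comp_mem_neat (h : α ≤ β) (θ : Set.Iio β → Set.Iio α) (x : B) :
    sub (incl h ∘ θ) x ∈ neatSubalgebra α B := by
  have hempty : (incl h ∘ θ) ⁻¹' extra α β = ∅ := by
    ext j
    simp only [Set.mem_preimage, Set.mem_empty_iff_false, iff_false]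
    exact not_le_of_gt (Set.mem_Iio.mp (θ j).2)
  change cyl (extra α β) (sub (incl h ∘ θ) x) = _
  rw [cyl_sub, hempty, cyl_empty]
  rw [hempty]
  exact Set.injOn_empty _

/-- The element `b` of `Nr_α B`, as an element of the algebra `Nr_α B`. -/
def toNeat (h : α ≤ β) (b : neatSubalgebra α B) : neatReduct h B := b

/-- The function `θ ↦ s_θ x` with values in the neat reduct. -/
noncomputable def restrictions (h : α ≤ β) (x : B) :
    Shrink.{u} (Set.Iio β → Set.Iio α) → neatReduct h B :=
  fun t => (⟨sub (incl h ∘ (equivShrink _).symm t) x, sub_incl_comp_mem_neat h _ x⟩ :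
    neatSubalgebra α B)

/-- At each `θ`, the two substitutions applied to `b` agree on `α`. This places the comparison map's
values in the dilation. -/
theorem restrictions_sub (h : α ≤ β) (σ : Set.Iio β → Set.Iio β) (b : neatSubalgebra α B) :
    restrictions h (sub σ b.1) =
      transported (σ ∘ incl h) (toNeat h b) := by
  refine funext fun t => Subtype.ext ?_
  change sub _ (sub σ b.1) = sub (extendId h _) b.1
  rw [← sub_comp]
  apply sub_congr_of_neat h b.2
  rw [extendId_comp_incl]
  rfl

variable [Infinite (Set.Iio α)]

/-- The inner factors of the common factorization are maps `α → α`, so they act within the neat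
reduct. -/
theorem exists_common_sub (h : α ≤ β) {b c : B} (hb : b ∈ neatSubalgebra α B)
    (hc : c ∈ neatSubalgebra α B) (σ τ : Set.Iio β → Set.Iio β) :
    ∃ (π : Set.Iio β → Set.Iio β) (b' c' : B), Function.Injective (π ∘ incl h) ∧
      b' ∈ neatSubalgebra α B ∧ c' ∈ neatSubalgebra α B ∧ sub σ b = sub π b' ∧
      sub τ c = sub π c' := by
  obtain ⟨ρ, θ₁, θ₂, hρ, h₁, h₂⟩ := exists_common_injection (incl h) (σ ∘ incl h) (τ ∘ incl h)
  obtain ⟨π, rfl, -⟩ := exists_extension h ρ (incl h (Classical.arbitrary _))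
  refine ⟨π, sub (extendId h θ₁) b, sub (extendId h θ₂) c, hρ, sub_extendId_mem_neat h hb _,
    sub_extendId_mem_neat h hc _, ?_, ?_⟩
  · rw [← sub_comp]
    apply sub_congr_of_neat h hb
    rw [h₁, Function.comp_assoc, Function.comp_assoc, extendId_comp_incl]
  · rw [← sub_comp]
    apply sub_congr_of_neat h hc
    rw [h₂, Function.comp_assoc, Function.comp_assoc, extendId_comp_incl]

/-- The elements obtained by substitution from the neat reduct form a subuniverse. -/
theorem isSubuniverse_sub_neat (h : α ≤ β) (B : PA β) :
    IsSubuniverse (Set.Iio β)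
      {x : B | ∃ (σ : Set.Iio β → Set.Iio β) (b : B), b ∈ neatSubalgebra α B ∧ x = sub σ b} where
  bot_mem := ⟨id, ⊥, BooleanSubalgebra.bot_mem, (sub_id _).symm⟩
  top_mem := ⟨id, ⊤, BooleanSubalgebra.top_mem, (sub_id _).symm⟩
  sup_mem := by
    rintro _ ⟨σ, b, hb, rfl⟩ _ ⟨τ, c, hc, rfl⟩
    obtain ⟨π, b', c', -, hb', hc', e₁, e₂⟩ := exists_common_sub h hb hc σ τ
    exact ⟨π, b' ⊔ c', BooleanSubalgebra.sup_mem hb' hc', by rw [e₁, e₂, PolyadicAlgebra.sub_sup]⟩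
  inf_mem := by
    rintro _ ⟨σ, b, hb, rfl⟩ _ ⟨τ, c, hc, rfl⟩
    obtain ⟨π, b', c', -, hb', hc', e₁, e₂⟩ := exists_common_sub h hb hc σ τ
    exact ⟨π, b' ⊓ c', BooleanSubalgebra.inf_mem hb' hc', by rw [e₁, e₂, PolyadicAlgebra.sub_inf]⟩
  compl_mem := by
    rintro _ ⟨σ, b, hb, rfl⟩
    exact ⟨σ, bᶜ, BooleanSubalgebra.compl_mem hb, (sub_compl σ b).symm⟩
  cyl_mem := by
    rintro Γ _ ⟨σ, b, hb, rfl⟩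
    obtain ⟨π, b', -, hπ, hb', -, e, -⟩ := exists_common_sub h hb hb σ σ
    exact ⟨π, _, cyl_mem_neat h hb' _, by rw [e, cyl_sub_of_neat h hb' hπ]⟩
  sub_mem := by
    rintro τ _ ⟨σ, b, hb, rfl⟩
    exact ⟨τ ∘ σ, b, hb, (sub_comp τ σ b).symm⟩

theorem exists_eq_sub (h : α ≤ β) (hB : generatedByNeat α β B) (x : B) :
    ∃ (σ : Set.Iio β → Set.Iio β) (b : B), b ∈ neatSubalgebra α B ∧ x = sub σ b := by
  have hx : x ∈ Sg (Set.Iio β) (neatSubalgebra α B : Set B) := hB ▸ Set.mem_univ x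
  exact hx _ ⟨isSubuniverse_sub_neat h B, fun b hb => ⟨id, b, hb, (sub_id b).symm⟩⟩

theorem exists_eq_sub₂ (h : α ≤ β) (hB : generatedByNeat α β B) (x y : B) :
    ∃ (π : Set.Iio β → Set.Iio β) (b c : B), Function.Injective (π ∘ incl h) ∧
      b ∈ neatSubalgebra α B ∧ c ∈ neatSubalgebra α B ∧ x = sub π b ∧ y = sub π c := by
  obtain ⟨σ, b, hb, rfl⟩ := exists_eq_sub h hB x
  obtain ⟨τ, c, hc, rfl⟩ := exists_eq_sub h hB y
  exact exists_common_sub h hb hc σ τ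

end Neat

/-- The image of `s_σ b` is determined by that of `b`. This faithfulness gives both uniqueness
claims. -/
theorem Nr_map_injective [Infinite (Set.Iio α)] (h : α ≤ β) {B B' : NeatlyGenerated α β}
    {f g : B ⟶ B'} (hfg : (Nr h).map f = (Nr h).map g) : f = g := by
  refine ObjectProperty.hom_ext _ (hom_ext fun x => ?_)
  obtain ⟨σ, b, hb, rfl⟩ := exists_eq_sub h B.property x
  rw [f.hom.map_sub, g.hom.map_sub]
  exact congrArg (sub σ) (congrArg (fun k : (Nr h).obj B ⟶ (Nr h).obj B' =>
    (show neatSubalgebra α B'.obj from k.toHom ⟨b, hb⟩).1) hfg)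

/-! ### The dilation functor and the natural isomorphisms -/

section Functor

variable [Infinite (Set.Iio α)] (h : α ≤ β)

/-- The dilation of `A` to dimension `β`. -/
noncomputable def dilate (A : PA α) : PA β := ⟨dilation A (incl h)⟩

theorem mk_incl_mem_neat (A : PA α) (a : A) :
    (dilation.mk (incl h) (incl h) a : dilate h A) ∈ neatSubalgebra α (dilate h A) := by
  change cyl (extra α β) (dilation.mk (incl h) (incl h) a) = _
  have hempty : incl h ⁻¹' extra α β = ∅ := by
    rw [← compl_range_incl h, Set.preimage_compl, Set.preimage_range, Set.compl_univ]
  rw [dilation.cyl_mk _ _ (incl h).injective, hempty, cyl_empty]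

/-- The embedding of `A` into the neat reduct of its dilation. -/
noncomputable def toNeatDilate (A : PA α) : A ⟶ neatReduct h (dilate h A) where
  toHom :=
    { toFun := fun a => (⟨dilation.mk (incl h) (incl h) a, mk_incl_mem_neat h A a⟩ :
        neatSubalgebra α (dilate h A))
      map_sup' := fun a b => Subtype.ext (dilation.mk_sup _ _ a b)
      map_inf' := fun a b => Subtype.ext (dilation.mk_inf _ _ a b)
      map_top' := Subtype.ext (dilation.mk_top _ _)
      map_bot' := Subtype.ext (dilation.mk_bot _ _) }
  map_cyl Γ a := Subtype.ext <| by
    refine Eq.trans ?_ (dilation.cyl_mk (incl h) (lift h Γ) (incl h).injective a).symm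
    rw [preimage_incl_lift]
    rfl
  map_sub τ a := Subtype.ext <| by
    refine Eq.trans ?_ (dilation.sub_mk (incl h) (extendId h τ) (incl h) a).symm
    rw [extendId_comp_incl, dilation.mk_comp]
    rfl
  injective a b hab := dilation.mk_injective (incl h) (incl h).injective (congrArg Subtype.val hab)

theorem toNeatDilate_surjective (A : PA α) : Function.Surjective (toNeatDilate h A).toHom := by
  rintro ⟨x, hx⟩
  obtain ⟨a, rfl⟩ := dilation.exists_eq_mk_of_cyl_eq (incl h) (x := x)
    (by rw [compl_range_incl]; exact hx)
  exact ⟨a, rfl⟩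

/-- An element `s_ρ a` is obtained from the copy of `a` by one substitution extending `ρ`. -/
theorem isMinimalDilation_toNeatDilate (A : PA α) : IsMinimalDilation h (toNeatDilate h A) := by
  refine Set.eq_univ_of_forall fun x => ?_
  rintro S ⟨hS, hA⟩
  obtain ⟨⟨ρ, a⟩, -, rfl⟩ := dilation.exists_mk (incl h) x
  obtain ⟨σ, rfl, -⟩ := exists_extension h ρ (incl h (Classical.arbitrary _))
  have := hS.sub_mem σ _ (hA ⟨a, rfl⟩)
  exact (dilation.sub_mk (incl h) σ (incl h) a) ▸ this

theorem generatedByNeat_dilate (A : PA α) : generatedByNeat α β (dilate h A) := by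
  refine Set.eq_univ_of_univ_subset ?_
  rw [← isMinimalDilation_toNeatDilate h A]
  rintro x hx S ⟨hS, hN⟩
  refine hx S ⟨hS, ?_⟩
  rintro _ ⟨a, rfl⟩
  exact hN (mk_incl_mem_neat h A a)

/-- The embedding of dilations induced by an embedding. -/
noncomputable def dilateMap {A A' : PA α} (g : A ⟶ A') : dilate h A ⟶ dilate h A' where
  toHom :=
    { toFun := fun x => (⟨fun t => g.toHom (x.1 t), by
        obtain ⟨_, ρ, a, rfl⟩ := x
        exact ⟨ρ, g.toHom a, funext fun t => g.map_sub _ a⟩⟩ : dilation A' (incl h))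
      map_sup' := fun _ _ => Subtype.ext (funext fun _ => map_sup g.toHom _ _)
      map_inf' := fun _ _ => Subtype.ext (funext fun _ => map_inf g.toHom _ _)
      map_top' := Subtype.ext (funext fun _ => map_top g.toHom)
      map_bot' := Subtype.ext (funext fun _ => map_bot g.toHom) }
  map_cyl Γ x := by
    have key : ∀ (ρ : Set.Iio α → Set.Iio β) (a : A),
        (⟨fun t => g.toHom ((dilation.mk (incl h) ρ a).1 t),
          ρ, g.toHom a, funext fun t => g.map_sub _ a⟩ : dilation A' (incl h)) =
        dilation.mk (incl h) ρ (g.toHom a) :=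
      fun ρ a => Subtype.ext (funext fun t => g.map_sub _ a)
    -- Over an injective `ρ` the cylinder formula holds in both dilations, and `g` keeps `ρ` fixed.
    obtain ⟨⟨ρ, a⟩, hρ, rfl⟩ := dilation.exists_mk (incl h) x
    have e₁ := dilation.cyl_mk (incl h) Γ hρ a
    have e₂ := dilation.cyl_mk (incl h) Γ hρ (g.toHom a)
    rw [← g.map_cyl, ← key, ← key] at e₂
    exact (Subtype.ext (funext fun t => congrArg (fun y => g.toHom (y.1 t)) e₁)).trans e₂.symm
  map_sub _ _ := rfl
  injective _ _ hxy := Subtype.ext (funext fun t =>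
    g.injective (congrFun (congrArg Subtype.val hxy) t))

theorem dilateMap_mk {A A' : PA α} (g : A ⟶ A') (ρ : Set.Iio α → Set.Iio β) (a : A) :
    (dilateMap h g).toHom (dilation.mk (incl h) ρ a) = dilation.mk (incl h) ρ (g.toHom a) :=
  Subtype.ext (funext fun _ => g.map_sub _ a)

/-- The dilation functor. -/
noncomputable def dilationFunctor : PA α ⥤ NeatlyGenerated α β where
  obj A := ⟨dilate h A, generatedByNeat_dilate h A⟩
  map g := ObjectProperty.homMk (dilateMap h g)
  map_id _ := rfl
  map_comp _ _ := rfl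

/-- Every algebra is isomorphic to the neat reduct of its dilation. -/
noncomputable def neatDilationIso : 𝟭 (PA α) ≅ dilationFunctor h ⋙ Nr h :=
  NatIso.ofComponents
    (fun A => isoOfSurjective (B := neatReduct h (dilate h A)) (toNeatDilate h A)
      (toNeatDilate_surjective h A))
    (fun {_ _} g => hom_ext fun a => Subtype.ext (dilateMap_mk h g (incl h) a).symm)

/-- An algebra generated by its neat reduct maps to the dilation of the neat reduct. -/
noncomputable def toDilateNeatFun (B : NeatlyGenerated α β) (x : B.obj) :
    dilation (neatReduct h B.obj) (incl h) :=
  ⟨restrictions h x, by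
    obtain ⟨σ, b, hb, rfl⟩ := exists_eq_sub h B.property x
    exact ⟨_, _, restrictions_sub h σ ⟨b, hb⟩⟩⟩

theorem toDilateNeatFun_sub (B : NeatlyGenerated α β) (σ : Set.Iio β → Set.Iio β)
    (b : neatSubalgebra α B.obj) :
    toDilateNeatFun h B (sub σ b.1) =
      dilation.mk (incl h) (σ ∘ incl h) (toNeat h b) :=
  Subtype.ext (restrictions_sub h σ b)

/-- An algebra generated by its neat reduct embeds into the dilation of the neat reduct. -/
noncomputable def toDilateNeat (B : NeatlyGenerated α β) :
    B.obj ⟶ dilate h (neatReduct h B.obj) where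
  toHom :=
    { toFun := toDilateNeatFun h B
      map_sup' := fun _ _ =>
        Subtype.ext (funext fun _ => Subtype.ext (PolyadicAlgebra.sub_sup _ _ _))
      map_inf' := fun _ _ =>
        Subtype.ext (funext fun _ => Subtype.ext (PolyadicAlgebra.sub_inf _ _ _))
      map_top' := Subtype.ext (funext fun _ => Subtype.ext (sub_top _))
      map_bot' := Subtype.ext (funext fun _ => Subtype.ext (sub_bot _)) }
  map_cyl Γ x := by
    -- Injectivity on `α` makes the cylinder formula available both in `B` and in the dilation.
    obtain ⟨σ, b, -, hσ, hb, -, rfl, -⟩ := exists_eq_sub₂ h B.property x x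
    change toDilateNeatFun h B (cyl Γ (sub σ b)) = cyl Γ (toDilateNeatFun h B (sub σ b))
    rw [cyl_sub_of_neat h hb hσ, toDilateNeatFun_sub h B σ ⟨b, hb⟩,
      toDilateNeatFun_sub h B σ ⟨_, cyl_mem_neat h hb _⟩, dilation.cyl_mk (incl h) Γ hσ]
    rfl
  map_sub τ x := Subtype.ext <| funext fun t => Subtype.ext <| by
    change sub _ (sub τ x) = sub (incl h ∘ (equivShrink _).symm (equivShrink _ _)) x
    rw [Equiv.symm_apply_apply, ← sub_comp]
    rfl
  injective x y hxy := by
    obtain ⟨σ, b, c, hσ, hb, hc, rfl, rfl⟩ := exists_eq_sub₂ h B.property x y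
    have hxy' : toDilateNeatFun h B (sub σ b) = toDilateNeatFun h B (sub σ c) := hxy
    rw [toDilateNeatFun_sub h B σ ⟨b, hb⟩, toDilateNeatFun_sub h B σ ⟨c, hc⟩] at hxy'
    have hbc : toNeat h ⟨b, hb⟩ = toNeat h ⟨c, hc⟩ := dilation.mk_injective (incl h) hσ hxy'
    exact congrArg (fun z : neatSubalgebra α B.obj => sub σ z.1) hbc

theorem toDilateNeat_surjective (B : NeatlyGenerated α β) :
    Function.Surjective (toDilateNeat h B).toHom := by
  intro x
  obtain ⟨⟨ρ, a⟩, -, rfl⟩ := dilation.exists_mk (incl h) x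
  obtain ⟨σ, rfl, -⟩ := exists_extension h ρ (incl h (Classical.arbitrary _))
  exact ⟨sub σ (show neatSubalgebra α B.obj from a).1, toDilateNeatFun_sub h B σ
    (show neatSubalgebra α B.obj from a)⟩

theorem Nr_map_toDilateNeat (B : NeatlyGenerated α β) :
    (neatReductFunctor h).map (toDilateNeat h B) = toNeatDilate h (neatReduct h B.obj) := by
  refine hom_ext fun b => Subtype.ext ?_
  have e := toDilateNeatFun_sub h B id (show neatSubalgebra α B.obj from b)
  rw [sub_id] at e
  exact e

/-- Every algebra generated by its neat reduct is isomorphic to the dilation of the neat reduct. -/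
noncomputable def dilationNeatIso : 𝟭 (NeatlyGenerated α β) ≅ Nr h ⋙ dilationFunctor h :=
  NatIso.ofComponents
    (fun B => (generatedByNeat α β).isoMk
      (isoOfSurjective (toDilateNeat h B) (toDilateNeat_surjective h B)))
    (fun {_ _} f => ObjectProperty.hom_ext _ <| hom_ext fun x => Subtype.ext <| funext fun t =>
      Subtype.ext (f.hom.map_sub (incl h ∘ (equivShrink _).symm t) x).symm)

end Functor

end PA

/-! ### The equivalence -/

theorem mainTheorem1 (α β : Ordinal.{u}) (hα : ω ≤ α) (hαβ : α < β) :
    (PA.Nr hαβ.le).IsEquivalence ∧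
    ∃ (G : PA α ⥤ PA.NeatlyGenerated α β)
      (μ : 𝟭 (PA.NeatlyGenerated α β) ≅ PA.Nr hαβ.le ⋙ G)
      (ε : G ⋙ PA.Nr hαβ.le ≅ 𝟭 (PA α)),
      (∀ A : PA α, PA.IsMinimalDilation hαβ.le (B := (G.obj A).obj) (ε.inv.app A)) ∧
      (∀ (A A' : PA α) (g : A ⟶ A') (f : G.obj A ⟶ G.obj A'),
        (PA.Nr hαβ.le).map f = ε.hom.app A ≫ g ≫ ε.inv.app A' ↔ f = G.map g) ∧
      (∀ (B : PA.NeatlyGenerated α β) (f : B ⟶ G.obj ((PA.Nr hαβ.le).obj B)),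
        (PA.Nr hαβ.le).map f = ε.inv.app ((PA.Nr hαβ.le).obj B) ↔ f = μ.hom.app B) := by
  have : Infinite (Set.Iio α) := by
    rw [Cardinal.infinite_iff, Cardinal.mk_Iio_ordinal]
    rw [← Cardinal.lift_aleph0.{u + 1, u}, Cardinal.lift_le]
    exact Ordinal.aleph0_le_card.mpr hα
  refine ⟨(CategoryTheory.Equivalence.mk (PA.Nr hαβ.le) (PA.dilationFunctor hαβ.le)
    (PA.dilationNeatIso hαβ.le) (PA.neatDilationIso hαβ.le).symm).isEquivalence_functor,
    PA.dilationFunctor hαβ.le, PA.dilationNeatIso hαβ.le, (PA.neatDilationIso hαβ.le).symm,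
    PA.isMinimalDilation_toNeatDilate hαβ.le, fun A A' g f => ?_, fun B f => ?_⟩
  · have hg : (PA.Nr hαβ.le).map ((PA.dilationFunctor hαβ.le).map g) =
        (PA.neatDilationIso hαβ.le).symm.hom.app A ≫ g ≫
          (PA.neatDilationIso hαβ.le).symm.inv.app A' := by
      rw [Iso.symm_hom, Iso.symm_inv]
      -- Naturality of `A → Nr_α G(A)` shows that `G(g)` satisfies the equation; faithfulness
      -- excludes any other solution.
      have e := (PA.neatDilationIso hαβ.le).hom.naturality g
      rw [Functor.id_map] at e
      rw [e, Iso.inv_hom_id_app_assoc]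
      rfl
    rw [← hg]
    exact ⟨PA.Nr_map_injective hαβ.le, fun e => e ▸ rfl⟩
  · have hμ : (PA.Nr hαβ.le).map ((PA.dilationNeatIso hαβ.le).hom.app B) =
        (PA.neatDilationIso hαβ.le).symm.inv.app ((PA.Nr hαβ.le).obj B) :=
      PA.Nr_map_toDilateNeat hαβ.le B
    rw [← hμ]
    exact ⟨PA.Nr_map_injective hαβ.le, fun e => e ▸ rfl⟩
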